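/- For every sample size $n\ge 1$ let $\mathbf Y=\mathbf X\beta^0+\varepsilon$ with a fixed $n\times p$ design matrix $\mathbf X$, $\beta^0\in\mathbb R^p$ and $\varepsilon\sim\mathcal N_n(0,\sigma^2 I)$, $\sigma>0$, where $p$, $\mathbf X$, $\beta^0$, $\sigma$ may all depend on $n$. Put $S_0=\{j:\beta^0_j\neq 0\}$. Let $\mathcal T$ be a (non-random) hierarchy of clusters, i.e. a set of subsets of $\{1,\dots,p\}$ that contains $\{1,\dots,p\}$ and in which any two sets are nested or disjoint, and let $\mathcal T_0$ be the set of all $C\in\mathcal T$ with $\beta^0_j=0$ for all $j\in C$. Fix the number $B\ge 1$ of sample splits. For $b=1,\dots,B$ let $\{1,\dots,n\}=N^{(b)}_{in}\cup N^{(b)}_{out}$ be a split into disjoint parts with $|N^{(b)}_{out}|=|N^{(b)}_{in}|$ if $n$ is even and $|N^{(b)}_{out}|=|N^{(b)}_{in}|+1$ if $n$ is odd, and let $\hat S^{(b)}\subseteq\{1,\dots,p\}$ be selected by a screening procedure that uses only the observations in $N^{(b)}_{in}$; the splits, and any additional randomization in the screening, are jointly independent of $\varepsilon$. Assume that the matrix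 $\mathbf X_{N^{(b)}_{out},\hat S^{(b)}}$ with rows in $N^{(b)}_{out}$ and columns in $\hat S^{(b)}$ has full column rank. For $C\in\mathcal T$ with $C\cap\hat S^{(b)}\neq\emptyset$ let $p^{C,(b)}$ be the p-value of the classical partial F-test, based on the observations in $N^{(b)}_{out}$, of the hypothesis that the coefficients in $C\cap\hat S^{(b)}$ vanish in the linear model with variables $\hat S^{(b)}$, and put $$p^{C,(b)}_{adj}=\min\Big(p^{C,(b)}\,\frac{|\hat S^{(b)}|}{|C\cap\hat S^{(b)}|},\,1\Big);$$ put $p^{C,(b)}_{adj}=1$ if $C\cap\hat S^{(b)}=\emptyset$. For $\gamma\in(0,1)$ and a fixed $\gamma_{\min}\in(0,1)$ define $$Q^C(\gamma)=\min\big\{1,\,q_\gamma\big(\{p^{C,(b)}_{adj}/\gamma;\ b=1,\dots,B\}\big)\big\},\qquad P^C=\min\Big\{1,\,(1-\log\gamma_{\min})\inf_{\gamma\in(\gamma_{\min},1)}Q^C(\gamma)\Big\},$$ where $q_\gamma$ is the empirical $\gamma$-quantile, i.e. the smallest $t$ such that at least a fraction $\gamma$ of the $B$ values is at most $t$, and $$Q^C_h(\gamma)=\max_{D\in\mathcal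 T:\,C\subseteq D}Q^D(\gamma),\qquad P^C_h=\max_{D\in\mathcal T:\,C\subseteq D}P^D .$$ For $\alpha\in(0,1)$ let $\mathcal T^\gamma_{rej}=\{C\in\mathcal T: Q^C_h(\gamma)\le\alpha\}$ and $\mathcal T_{rej}=\{C\in\mathcal T: P^C_h\le\alpha\}$. Assume (A1): $|\hat S^{(b)}|<n/2$ for every $b$ and every $n \ge 1$, and (A2'): $\lim_{n\to\infty}\mathbb P[\hat S^{(b)}\supseteq S_0]=1$ for every $b$. Then for any fixed $\gamma\in(0,1)$ and significance level $\alpha\in(0,1)$, $$\limsup_{n\to\infty}\mathbb P\big(\mathcal T^\gamma_{rej}\cap\mathcal T_0\neq\emptyset\big)\le\alpha\qquad\text{and}\qquad\limsup_{n\to\infty}\mathbb P\big(\mathcal T_{rej}\cap\mathcal T_0\neq\emptyset\big)\le\alpha .$$ -/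

import Mathlib

open MeasureTheory ProbabilityTheory Filter Topology

universe u v

noncomputable section

namespace HierTest

/-! ## The classical partial F-test -/

/-- The chi-squared distribution with `k` degrees of freedom: the law of the sum of the squares
of `k` independent standard normal variables. -/
def chiSq (k : ℕ) : Measure ℝ :=
  (Measure.pi fun _ : Fin k => gaussianReal 0 1).map fun z => ∑ i, z i ^ 2

/-- The (central) F-distribution with `d₁` and `d₂` degrees of freedom: the law of
`(U / d₁) / (V / d₂)` for independent chi-squared variables `U`, `V`. -/
def fDist (d₁ d₂ : ℕ) : Measure ℝ :=
  ((chiSq d₁).prod (chiSq d₂)).map fun w => (w.1 / d₁) / (w.2 / d₂)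

/-- Residual sum of squares of the least squares fit of `y` on the columns in `S` of the design
matrix `X`. -/
def rss {ι κ : Type*} [Fintype ι] (X : Matrix ι κ ℝ) (S : Finset κ) (y : ι → ℝ) : ℝ :=
  ⨅ b : κ → ℝ, ∑ i, (y i - ∑ j ∈ S, X i j * b j) ^ 2

/-- The partial F-statistic for the null hypothesis that all coefficients in `C ∩ S` vanish, in
the linear model whose variables are those in `S`. -/
def partialFStat {ι κ : Type*} [Fintype ι] [DecidableEq κ] (X : Matrix ι κ ℝ) (S C : Finset κ)
    (y : ι → ℝ) : ℝ :=
  ((rss X (S \ C) y - rss X S y) / ((C ∩ S).card : ℝ)) /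
    (rss X S y / ((Fintype.card ι : ℝ) - (S.card : ℝ)))

/-- The p-value of the partial F-test: the upper tail of the F-distribution with `|C ∩ S|` and
`(number of observations) - |S|` degrees of freedom, at the partial F-statistic. -/
def partialFPValue {ι κ : Type*} [Fintype ι] [DecidableEq κ] (X : Matrix ι κ ℝ) (S C : Finset κ)
    (y : ι → ℝ) : ℝ :=
  (fDist (C ∩ S).card (Fintype.card ι - S.card)).real (Set.Ici (partialFStat X S C y))

/-- The p-value of a cluster `C` for the selected set `S`: the partial F-test p-value if `C`
contains selected variables, and `1` otherwise. -/
def clusterPValue {ι κ : Type*} [Fintype ι] [DecidableEq κ] (X : Matrix ι κ ℝ) (S C : Finset κ)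
    (y : ι → ℝ) : ℝ :=
  if (C ∩ S).Nonempty then partialFPValue X S C y else 1

/-- The multiplicity adjusted p-value of a cluster. -/
def adjPValue {ι κ : Type*} [Fintype ι] [DecidableEq κ] (X : Matrix ι κ ℝ) (S C : Finset κ)
    (y : ι → ℝ) : ℝ :=
  if (C ∩ S).Nonempty then
    min (clusterPValue X S C y * ((S.card : ℝ) / ((C ∩ S).card : ℝ))) 1
  else 1

/-! ## Aggregation over sample splits -/

/-- The empirical `γ`-quantile of `x₁, …, x_B`: the smallest `t` such that at least a fraction `γ`
of the `x_b` is at most `t`. -/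
def empQuantile {B : ℕ} (γ : ℝ) (x : Fin B → ℝ) : ℝ :=
  sInf {t : ℝ | γ * (B : ℝ) ≤ ((Finset.univ.filter fun b => x b ≤ t).card : ℝ)}

/-- Aggregation of the p-values `x₁, …, x_B` with a fixed `γ`. -/
def aggQ {B : ℕ} (γ : ℝ) (x : Fin B → ℝ) : ℝ :=
  min 1 (empQuantile γ fun b => x b / γ)

/-- Aggregation of the p-values `x₁, …, x_B` with `γ` optimized over `(γmin, 1)`. -/
def aggP {B : ℕ} (γmin : ℝ) (x : Fin B → ℝ) : ℝ :=
  min 1 ((1 - Real.log γmin) * ⨅ γ : Set.Ioo γmin 1, aggQ (γ : ℝ) x)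

/-! ## The linear model and the hierarchical multi sample-splitting procedure -/

/-- A Gaussian linear model `Y = X β + ε` with `n` observations and fixed design, a hierarchy of
clusters of variables, and a screening procedure applied to `B` sample splits. -/
structure Setting (n B : ℕ) where
  /-- number of variables -/
  p : ℕ
  /-- design matrix -/
  X : Matrix (Fin n) (Fin p) ℝ
  /-- regression vector -/
  β : Fin p → ℝ
  /-- noise level -/
  σ : ℝ
  σ_pos : 0 < σ
  /-- the hierarchy: it contains the set of all variables, and any two clusters are nested or
  disjoint -/
  T : Finset (Finset (Fin p))
  root_mem : Finset.univ ∈ T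
  laminar : ∀ C ∈ T, ∀ D ∈ T, C ⊆ D ∨ D ⊆ C ∨ Disjoint C D
  /-- underlying probability space -/
  Ω : Type u
  [mΩ : MeasurableSpace Ω]
  /-- underlying probability measure -/
  P : Measure Ω
  [isProb : IsProbabilityMeasure P]
  /-- noise vector, with independent `N(0, σ²)` components -/
  ε : Ω → Fin n → ℝ
  measurable_ε : Measurable ε
  law_ε : P.map ε = Measure.pi fun _ => gaussianReal 0 (Real.toNNReal (σ ^ 2))
  /-- values of the random seed of one run of the algorithm (choice of the sample split and
  possible randomization inside the screening procedure) -/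
  R : Type v
  [mR : MeasurableSpace R]
  /-- random seed of the run `b` -/
  seed : Fin B → Ω → R
  measurable_seed : ∀ b, Measurable (seed b)
  /-- the seeds do not depend on the noise; the seeds of different runs may have any joint law -/
  indep : IndepFun ε (fun ω b => seed b ω) P
  /-- the part `N_in` of the sample split; the part `N_out` is its complement -/
  split : R → Finset (Fin n)
  measurable_split : ∀ N, MeasurableSet {r | split r = N}
  /-- the parts have equal size for even `n`, and `|N_out| = |N_in| + 1` for odd `n` -/
  card_split : ∀ r, (split r)ᶜ.card = (split r).card + n % 2
  /-- the screening procedure: it sees the seed, and the rows of the design and the responses in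
  `N_in` only -/
  screen : R → (N : Finset (Fin n)) → Matrix N (Fin p) ℝ → (N → ℝ) → Finset (Fin p)
  measurable_screen : ∀ (N : Finset (Fin n)) (S : Finset (Fin p)),
    MeasurableSet {q : R × (N → ℝ) |
      screen q.1 N (X.submatrix (fun i : N => (i : Fin n)) id) q.2 = S}

attribute [instance] Setting.mΩ Setting.isProb Setting.mR

namespace Setting

variable {n B : ℕ} (M : Setting.{u, v} n B)

/-- The response vector `Y = X β + ε`. -/
def Y (ω : M.Ω) (i : Fin n) : ℝ := ∑ j, M.X i j * M.β j + M.ε ω i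

/-- The active set. -/
def S₀ : Finset (Fin M.p) := Finset.univ.filter fun j => M.β j ≠ 0

/-- The first half `N_in` of the split `b`. -/
def Nin (b : Fin B) (ω : M.Ω) : Finset (Fin n) := M.split (M.seed b ω)

/-- The second half `N_out` of the split `b`. -/
def Nout (b : Fin B) (ω : M.Ω) : Finset (Fin n) := (M.Nin b ω)ᶜ

/-- The selected set of the split `b`. -/
def Shat (b : Fin B) (ω : M.Ω) : Finset (Fin M.p) :=
  M.screen (M.seed b ω) (M.Nin b ω)
    (M.X.submatrix (fun i : M.Nin b ω => (i : Fin n)) id) (fun i => M.Y ω i)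

/-- The rows of the design matrix that belong to `N_out`. -/
def Xout (b : Fin B) (ω : M.Ω) : Matrix (M.Nout b ω) (Fin M.p) ℝ :=
  M.X.submatrix (fun i : M.Nout b ω => (i : Fin n)) id

/-- The adjusted p-value of the cluster `C` in the split `b`, computed from the observations in
`N_out` and the selected set. -/
def padj (C : Finset (Fin M.p)) (b : Fin B) (ω : M.Ω) : ℝ :=
  adjPValue (M.Xout b ω) (M.Shat b ω) C fun i => M.Y ω i

/-- The aggregated p-value `Q^C(γ)`. -/
def Q (γ : ℝ) (C : Finset (Fin M.p)) (ω : M.Ω) : ℝ := aggQ γ fun b => M.padj C b ω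

/-- The aggregated p-value `P^C`. -/
def PC (γmin : ℝ) (C : Finset (Fin M.p)) (ω : M.Ω) : ℝ := aggP γmin fun b => M.padj C b ω

/-- The clusters of the hierarchy that contain `C`. -/
def above (C : Finset (Fin M.p)) : Finset (Finset (Fin M.p)) := M.T.filter fun D => C ⊆ D

theorem above_nonempty (C : Finset (Fin M.p)) : (M.above C).Nonempty :=
  ⟨Finset.univ, Finset.mem_filter.2 ⟨M.root_mem, Finset.subset_univ C⟩⟩

/-- The hierarchically adjusted p-value `Q_h^C(γ)`. -/
def Qh (γ : ℝ) (C : Finset (Fin M.p)) (ω : M.Ω) : ℝ :=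
  (M.above C).sup' (M.above_nonempty C) fun D => M.Q γ D ω

/-- The hierarchically adjusted p-value `P_h^C`. -/
def Ph (γmin : ℝ) (C : Finset (Fin M.p)) (ω : M.Ω) : ℝ :=
  (M.above C).sup' (M.above_nonempty C) fun D => M.PC γmin D ω

/-- The clusters whose null hypothesis `β_j = 0` for all `j ∈ C` is fulfilled. -/
def T₀ : Set (Finset (Fin M.p)) := {C | C ∈ M.T ∧ ∀ j ∈ C, M.β j = 0}

/-- The clusters rejected at level `α` on the basis of `Q_h^C(γ)`. -/
def TrejQ (γ α : ℝ) (ω : M.Ω) : Set (Finset (Fin M.p)) := {C | C ∈ M.T ∧ M.Qh γ C ω ≤ α}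

/-- The clusters rejected at level `α` on the basis of `P_h^C`. -/
def TrejP (γmin α : ℝ) (ω : M.Ω) : Set (Finset (Fin M.p)) := {C | C ∈ M.T ∧ M.Ph γmin C ω ≤ α}

/-- Sparsity property: in every split fewer than `n / 2` variables are selected. -/
def Sparsity : Prop := ∀ b, ∀ᵐ ω ∂M.P, ((M.Shat b ω).card : ℝ) < (n : ℝ) / 2

/-- The design matrix of every partial F-test, with rows in `N_out` and columns in the selected
set, has full column rank. -/
def FullRank : Prop := ∀ b, ∀ᵐ ω ∂M.P,
  ((M.Xout b ω).submatrix id (fun j : M.Shat b ω => (j : Fin M.p))).rank = (M.Shat b ω).card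

end Setting

end HierTest

end

/-!
The familywise error is controlled in three steps: validity of the partial F-test given the
selection, additivity over disjoint clusters, and a Markov bound for the aggregation over splits.

Fix one split. The selection depends on the seed and on the noise in `N_in` only, hence is
independent of the noise in `N_out`. If the selected set `S` contains the active set and `C` is a
cluster without active variables, the mean of the responses lies in the span of the columns in
`S \ C`, so the residual sums of squares only involve the noise. By rotation invariance of the
Gaussian law they give independent chi-squared variables, and the F-test p-value is stochastically
larger than uniform (`HierTest.map_partialFStat`, `HierTest.measure_partialFPValue_le`). The adjusted
p-value of `C` is then at most `x` with probability at most `x |C ∩ S| / |S|`, and for disjoint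
clusters these bounds add up to at most `x` (`HierTest.sum_measure_adjPValue_le`,
`HierTest.Setting.sum_measure_padj_le`).

A hierarchical rejection of any true null hypothesis requires that the aggregated p-value of some
maximal true null cluster is at most `α`, and these maximal clusters are disjoint because the
hierarchy is laminar. It remains to bound the probability that an aggregated p-value is small. Both
aggregation rules admit a measure `ν` on levels `s ∈ [0, 1)` such that an aggregate of at most `α`
forces `∑ b, ν {s | p_b ≤ s} ≥ B`, while `∫ s dν` is at most any prescribed number above `α`
(`HierTest.LevelDominated`): a point mass for a fixed `γ`, and for the optimized `γ` a
point mass plus an image of Lebesgue measure, where the factor `1 - log γmin` pays for the larger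
integral. Markov's inequality and Tonelli's theorem turn the bound at a fixed level `s` into one
for the aggregate
(`HierTest.Setting.measure_exists_le_sum_measure_Ici_le`). For every sample size the familywise
error is therefore at most `α` plus the probability that the screening fails in some split
(`HierTest.Setting.measure_false_rejection_le`), and the latter tends to zero.
-/

namespace HierTest

open scoped RealInnerProductSpace

/-! ### Orthogonal projections of a standard Gaussian vector -/

section Gaussian

variable {E : Type*} [NormedAddCommGroup E] [InnerProductSpace ℝ E] [FiniteDimensional ℝ E]
  [MeasurableSpace E] [BorelSpace E]

/-- The coefficients of a standard Gaussian vector along an orthonormal family, which need not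
span the space, are independent standard normal variables. -/
theorem stdGaussian_map_inner_orthonormal {κ : Type*} [Fintype κ] {u : κ → E}
    (hu : Orthonormal ℝ u) :
    (stdGaussian E).map (fun x i => ⟪u i, x⟫) = Measure.pi fun _ : κ => gaussianReal 0 1 := by
  classical
  set f : E →L[ℝ] EuclideanSpace ℝ κ := (EuclideanSpace.equiv κ ℝ).symm.toContinuousLinearMap ∘L
    ContinuousLinearMap.pi fun i => innerSL ℝ (u i) with hf
  have key : (stdGaussian E).map f = stdGaussian (EuclideanSpace ℝ κ) := by
    apply Measure.ext_of_charFun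
    ext t
    have hinner : ∀ x, ⟪f x, t⟫ = ⟪x, ∑ i, t i • u i⟫ := by
      intro x
      rw [PiLp.inner_apply, inner_sum]
      refine Finset.sum_congr rfl fun i _ => ?_
      rw [real_inner_smul_right, real_inner_comm]
      simp [hf, real_inner_comm, mul_comm]
    have hnorm : ‖∑ i, t i • u i‖ ^ 2 = ‖t‖ ^ 2 := by
      rw [← real_inner_self_eq_norm_sq, hu.inner_sum, EuclideanSpace.real_norm_sq_eq]
      simp [sq]
    have h1 : charFun ((stdGaussian E).map f) t = charFun (stdGaussian E) (∑ i, t i • u i) := by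
      rw [charFun_apply, charFun_apply, integral_map (by fun_prop) (by fun_prop)]
      simp_rw [hinner]
    rw [h1, charFun_stdGaussian, charFun_stdGaussian, ← Complex.ofReal_pow, hnorm,
      Complex.ofReal_pow]
  have h2 : (fun (x : E) i => ⟪u i, x⟫) = (WithLp.ofLp : EuclideanSpace ℝ κ → κ → ℝ) ∘ f := by
    ext x i
    simp [hf]
  have hm : Measurable (WithLp.ofLp : EuclideanSpace ℝ κ → κ → ℝ) := by fun_prop
  rw [h2, ← Measure.map_map hm (by fun_prop), key, ← map_pi_eq_stdGaussian,
    Measure.map_map hm (by fun_prop)]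
  exact Measure.map_id

instance isProbabilityMeasure_chiSq (k : ℕ) : IsProbabilityMeasure (chiSq k) :=
  Measure.isProbabilityMeasure_map (Measurable.aemeasurable (by fun_prop))

instance isProbabilityMeasure_fDist (k m : ℕ) : IsProbabilityMeasure (fDist k m) :=
  Measure.isProbabilityMeasure_map (by fun_prop)

/-- For two orthonormal families that are orthogonal to each other, the sums of the squared
coefficients of a standard Gaussian vector are independent chi-squared variables. -/
theorem stdGaussian_map_sum_sq_inner {k m : ℕ} {u : Fin k → E} {w : Fin m → E}
    (huw : Orthonormal ℝ (Sum.elim u w)) :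
    (stdGaussian E).map (fun x => (∑ i, ⟪u i, x⟫ ^ 2, ∑ i, ⟪w i, x⟫ ^ 2))
      = (chiSq k).prod (chiSq m) := by
  have h := stdGaussian_map_inner_orthonormal huw
  have hs := (measurePreserving_sumPiEquivProdPi
    (fun _ : Fin k ⊕ Fin m => gaussianReal 0 1)).map_eq
  rw [chiSq, chiSq, Measure.map_prod_map _ _ (by fun_prop) (by fun_prop), ← hs, ← h,
    Measure.map_map (MeasurableEquiv.measurable _) (by fun_prop),
    Measure.map_map (by fun_prop) (by fun_prop)]
  rfl

/-- For nested subspaces `W ≤ V`, the squared lengths of the projections of a standard Gaussian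
vector to `V ⊖ W` and to the orthogonal complement of `V` are independent chi-squared
variables. -/
theorem stdGaussian_map_norm_sq_projections {W V : Submodule ℝ E} (hWV : W ≤ V) {k m : ℕ}
    (hk : Module.finrank ℝ W + k = Module.finrank ℝ V)
    (hm : Module.finrank ℝ V + m = Module.finrank ℝ E) :
    (stdGaussian E).map (fun x => (‖x - W.starProjection x‖ ^ 2 - ‖x - V.starProjection x‖ ^ 2,
      ‖x - V.starProjection x‖ ^ 2)) = (chiSq k).prod (chiSq m) := by
  have hk' : Module.finrank ℝ (Wᗮ ⊓ V : Submodule ℝ E) = k :=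
    Submodule.finrank_add_inf_finrank_orthogonal' hWV hk
  have hm' : Module.finrank ℝ Vᗮ = m := Submodule.finrank_add_finrank_orthogonal' hm
  set bu := (stdOrthonormalBasis ℝ (Wᗮ ⊓ V : Submodule ℝ E)).reindex (finCongr hk') with hbu
  set bw := (stdOrthonormalBasis ℝ Vᗮ).reindex (finCongr hm') with hbw
  have horth : Orthonormal ℝ (Sum.elim (fun i => (bu i : E)) (fun i => (bw i : E))) := by
    rw [orthonormal_iff_ite]
    have h1 := orthonormal_iff_ite.1 bu.orthonormal
    have h2 := orthonormal_iff_ite.1 bw.orthonormal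
    have h3 : ∀ i j, ⟪(bu i : E), (bw j : E)⟫ = 0 := fun i j =>
      Submodule.inner_right_of_mem_orthogonal (bu i).2.2 (bw j).2
    rintro (i | i) (j | j)
    · simpa using h1 i j
    · simpa using h3 i j
    · simpa [real_inner_comm] using h3 j i
    · simpa using h2 i j
  rw [← stdGaussian_map_sum_sq_inner horth]
  congr 1
  ext x
  · set a := W.starProjection x with ha
    set c := V.starProjection x with hc
    have haW : a ∈ W := Submodule.starProjection_apply_mem W x
    have hcV : c ∈ V := Submodule.starProjection_apply_mem V x
    have hxa : x - a ∈ Wᗮ := Submodule.sub_starProjection_mem_orthogonal x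
    have hxc : x - c ∈ Vᗮ := Submodule.sub_starProjection_mem_orthogonal x
    have hxc' : x - c ∈ Wᗮ := Submodule.orthogonal_le hWV hxc
    have hd : c - a ∈ (Wᗮ ⊓ V : Submodule ℝ E) := by
      refine ⟨?_, V.sub_mem hcV (hWV haW)⟩
      have := Wᗮ.sub_mem hxa hxc'
      rwa [sub_sub_sub_cancel_left] at this
    have hpyth : ‖x - a‖ ^ 2 = ‖c - a‖ ^ 2 + ‖x - c‖ ^ 2 := by
      have h0 : ⟪c - a, x - c⟫ = 0 := Submodule.inner_right_of_mem_orthogonal hd.2 hxc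
      have := norm_add_sq_eq_norm_sq_add_norm_sq_of_inner_eq_zero _ _ h0
      rw [show x - a = (c - a) + (x - c) by abel]
      simpa [sq] using this
    have hsum : ∑ i, ⟪(bu i : E), x⟫ ^ 2 = ‖c - a‖ ^ 2 := by
      have := bu.sum_sq_inner_right ⟨c - a, hd⟩
      rw [show ‖c - a‖ = ‖(⟨c - a, hd⟩ : (Wᗮ ⊓ V : Submodule ℝ E))‖ from rfl, ← this]
      refine Finset.sum_congr rfl fun i _ => ?_
      congr 1
      change ⟪(bu i : E), x⟫ = ⟪(bu i : E), c - a⟫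
      rw [show x = (c - a) + (a + (x - c)) by abel, inner_add_right, inner_add_right,
        Submodule.inner_left_of_mem_orthogonal haW (bu i).2.1,
        Submodule.inner_right_of_mem_orthogonal (bu i).2.2 hxc]
      simp
    simp only [hsum, hpyth]
    ring
  · set c := V.starProjection x with hc
    have hcV : c ∈ V := Submodule.starProjection_apply_mem V x
    have hxc : x - c ∈ Vᗮ := Submodule.sub_starProjection_mem_orthogonal x
    have := bw.sum_sq_inner_right ⟨x - c, hxc⟩
    change ‖x - c‖ ^ 2 = _
    rw [show ‖x - c‖ = ‖(⟨x - c, hxc⟩ : Vᗮ)‖ from rfl, ← this]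
    refine Finset.sum_congr rfl fun i _ => ?_
    congr 1
    change ⟪(bw i : E), x - c⟫ = ⟪(bw i : E), x⟫
    rw [inner_sub_right, Submodule.inner_left_of_mem_orthogonal hcV (bw i).2, sub_zero]

end Gaussian

/-! ### Residual sums of squares -/

section Rss

variable {ι κ : Type*} (X : Matrix ι κ ℝ)

/-- The span of the columns in `S` of the matrix `X`, as a subspace of Euclidean space. -/
def colSpan (S : Finset κ) : Submodule ℝ (EuclideanSpace ℝ ι) :=
  Submodule.span ℝ (Set.range fun j : S => WithLp.toLp 2 fun i => X i j)

theorem mem_colSpan {S : Finset κ} {w : EuclideanSpace ℝ ι} :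
    w ∈ colSpan X S ↔ ∃ b : κ → ℝ, ∀ i, w i = ∑ j ∈ S, X i j * b j := by
  classical
  rw [colSpan, Submodule.mem_span_range_iff_exists_fun]
  constructor
  · rintro ⟨c, rfl⟩
    refine ⟨fun j => if h : j ∈ S then c ⟨j, h⟩ else 0, fun i => ?_⟩
    rw [← Finset.sum_coe_sort S]
    simp [mul_comm]
  · rintro ⟨b, hb⟩
    refine ⟨fun j => b j, ?_⟩
    ext i
    rw [hb, ← Finset.sum_coe_sort S]
    simp [mul_comm]

theorem colSpan_mono {S S' : Finset κ} (h : S ⊆ S') : colSpan X S ≤ colSpan X S' := by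
  refine Submodule.span_mono ?_
  rintro _ ⟨j, rfl⟩
  exact ⟨⟨j, h j.2⟩, rfl⟩

theorem finrank_colSpan {S : Finset κ}
    (h : LinearIndependent ℝ fun j : S => (WithLp.toLp 2 fun i => X i j : EuclideanSpace ℝ ι)) :
    Module.finrank ℝ (colSpan X S) = S.card := by
  rw [colSpan, finrank_span_eq_card h, Fintype.card_coe]

theorem linearIndependent_cols_of_rank {S : Finset κ}
    (h : (X.submatrix id (fun j : S => (j : κ))).rank = S.card) :
    LinearIndependent ℝ fun j : S => (WithLp.toLp 2 fun i => X i j : EuclideanSpace ℝ ι) := by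
  rw [Matrix.rank_eq_finrank_span_cols] at h
  have h1 : LinearIndependent ℝ (X.submatrix id (fun j : S => (j : κ))).col := by
    rw [linearIndependent_iff_card_eq_finrank_span, Set.finrank, h, Fintype.card_coe]
  exact h1.map' (WithLp.linearEquiv 2 ℝ (ι → ℝ)).symm.toLinearMap (LinearEquiv.ker _)

variable [Fintype ι]

/-- The residual sum of squares is the squared distance to the column span. -/
theorem rss_eq_norm_sq (S : Finset κ) (y : ι → ℝ) :
    rss X S y = ‖WithLp.toLp 2 y - (colSpan X S).starProjection (WithLp.toLp 2 y)‖ ^ 2 := by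
  set z : EuclideanSpace ℝ ι := WithLp.toLp 2 y with hz
  set a := (colSpan X S).starProjection z with ha
  have haV : a ∈ colSpan X S := Submodule.starProjection_apply_mem _ z
  have hza : z - a ∈ (colSpan X S)ᗮ := Submodule.sub_starProjection_mem_orthogonal z
  apply le_antisymm
  · obtain ⟨b, hb⟩ := (mem_colSpan X).1 haV
    have h0 : BddBelow (Set.range fun b : κ → ℝ => ∑ i, (y i - ∑ j ∈ S, X i j * b j) ^ 2) :=
      ⟨0, by rintro _ ⟨b, rfl⟩; positivity⟩
    refine (ciInf_le h0 b).trans_eq ?_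
    rw [EuclideanSpace.real_norm_sq_eq]
    simp [hz, hb]
  · refine le_ciInf fun b => ?_
    set w : EuclideanSpace ℝ ι := WithLp.toLp 2 fun i => ∑ j ∈ S, X i j * b j with hw
    have hwV : w ∈ colSpan X S := (mem_colSpan X).2 ⟨b, fun i => rfl⟩
    have h1 : ∑ i, (y i - ∑ j ∈ S, X i j * b j) ^ 2 = ‖z - w‖ ^ 2 := by
      rw [EuclideanSpace.real_norm_sq_eq]
      simp [hz, hw]
    have h0 : ⟪z - a, a - w⟫ = 0 :=
      Submodule.inner_left_of_mem_orthogonal (Submodule.sub_mem _ haV hwV) hza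
    have := norm_add_sq_eq_norm_sq_add_norm_sq_of_inner_eq_zero _ _ h0
    rw [sub_add_sub_cancel] at this
    rw [h1]
    nlinarith [mul_self_nonneg ‖a - w‖]

theorem continuous_rss (S : Finset κ) : Continuous (rss X S) := by
  simp_rw [funext (rss_eq_norm_sq X S)]
  fun_prop

/-- Under the model `y = m + σ z` with mean `m` in the column span, the residual sum of squares
only depends on the noise `z`. -/
theorem rss_add_smul {S : Finset κ} {m : ι → ℝ} (hm : WithLp.toLp 2 m ∈ colSpan X S) (σ : ℝ)
    (z : ι → ℝ) :
    rss X S (fun i => m i + σ * z i) = σ ^ 2 *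
      ‖WithLp.toLp 2 z - (colSpan X S).starProjection (WithLp.toLp 2 z)‖ ^ 2 := by
  rw [rss_eq_norm_sq]
  have h : WithLp.toLp 2 (fun i => m i + σ * z i)
      = (WithLp.toLp 2 m + σ • WithLp.toLp 2 z : EuclideanSpace ℝ ι) := by
    ext i; simp
  rw [h, map_add, map_smul, Submodule.starProjection_eq_self_iff.2 hm, add_sub_add_left_eq_sub,
    ← smul_sub, norm_smul, mul_pow]
  simp

theorem measurable_partialFStat [DecidableEq κ] (S C : Finset κ) :
    Measurable (partialFStat X S C) := by
  unfold partialFStat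
  have h1 := (continuous_rss X (S \ C)).measurable
  have h2 := (continuous_rss X S).measurable
  fun_prop

@[fun_prop]
theorem measurable_partialFStat_add [DecidableEq κ] (S C : Finset κ) (m : ι → ℝ) :
    Measurable fun e : ι → ℝ => partialFStat X S C fun i => m i + e i :=
  (measurable_partialFStat X S C).comp
    (measurable_pi_lambda _ fun i => measurable_const.add (measurable_pi_apply i))

theorem measurable_adjPValue [DecidableEq κ] (S C : Finset κ) :
    Measurable (adjPValue X S C) := by
  have h : Measurable (clusterPValue X S C) := by
    unfold clusterPValue
    split_ifs
    · have hanti : Antitone fun t : ℝ =>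
          (fDist (C ∩ S).card (Fintype.card ι - S.card)).real (Set.Ici t) := by
        exact fun s t hst => measureReal_mono (Set.Ici_subset_Ici.2 hst)
      exact hanti.measurable.comp (measurable_partialFStat X S C)
    · exact measurable_const
  unfold adjPValue
  split_ifs
  · fun_prop
  · exact measurable_const

end Rss

/-! ### The null distribution of the partial F-test -/

/-- Upper tail probabilities, evaluated at the random variable itself, are stochastically larger
than a uniform variable, whether or not the distribution has atoms. -/
theorem measure_tail_le {ν : Measure ℝ} (u : ENNReal) : ν {t | ν (Set.Ici t) ≤ u} ≤ u := by
  set A := {t | ν (Set.Ici t) ≤ u} with hA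
  have hup : ∀ s ∈ A, Set.Ici s ⊆ A := fun s hs t hst =>
    (measure_mono (Set.Ici_subset_Ici.2 hst)).trans hs
  rcases A.eq_empty_or_nonempty with h | hne
  · simp [h]
  by_cases hmin : ∃ s ∈ A, ∀ t ∈ A, s ≤ t
  · obtain ⟨s, hs, hst⟩ := hmin
    exact (measure_mono fun t ht => hst t ht).trans hs
  push Not at hmin
  -- without a least element, `A` is the union of the rays from its points, and countably many
  -- rational starting points suffice
  have hU : A = ⋃ q ∈ {q : ℚ | (q : ℝ) ∈ A}, Set.Ici (q : ℝ) := by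
    ext t
    simp only [Set.mem_iUnion, Set.mem_Ici, exists_prop, Set.mem_ofPred_eq]
    constructor
    · intro ht
      obtain ⟨s, hs, hst⟩ := hmin t ht
      obtain ⟨q, hq1, hq2⟩ := exists_rat_btwn hst
      exact ⟨q, hup s hs hq1.le, hq2.le⟩
    · rintro ⟨q, hq, hqt⟩
      exact hup _ hq hqt
  rw [hU, measure_biUnion_eq_iSup (Set.to_countable _)]
  · exact iSup₂_le fun q hq => hq
  · intro q hq r hr
    rcases le_total q r with h | h
    · exact ⟨q, hq, subset_rfl, Set.Ici_subset_Ici.2 (by exact_mod_cast h)⟩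
    · exact ⟨r, hr, Set.Ici_subset_Ici.2 (by exact_mod_cast h), subset_rfl⟩

section FTest

variable {ι κ : Type*} [Fintype ι] [DecidableEq κ] (X : Matrix ι κ ℝ)

theorem pi_gaussianReal_eq_map (σ : ℝ) :
    Measure.pi (fun _ : ι => gaussianReal 0 (Real.toNNReal (σ ^ 2)))
      = (Measure.pi fun _ : ι => gaussianReal 0 1).map fun z i => σ * z i := by
  rw [Measure.pi_map_pi (f := fun _ x => σ * x) (fun _ => by fun_prop)]
  simp_rw [gaussianReal_map_const_mul]
  congr 2
  ext i : 1
  congr 1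
  · simp
  · ext; simp [sq_nonneg]

/-- Under the null hypothesis, the partial F-statistic has an F-distribution. -/
theorem map_partialFStat {S C : Finset κ} {σ : ℝ} (hσ : 0 < σ)
    (hrank : (X.submatrix id (fun j : S => (j : κ))).rank = S.card)
    {m : ι → ℝ} (hm : WithLp.toLp 2 m ∈ colSpan X (S \ C)) :
    (Measure.pi fun _ : ι => gaussianReal 0 (Real.toNNReal (σ ^ 2))).map
        (fun e => partialFStat X S C fun i => m i + e i)
      = fDist (C ∩ S).card (Fintype.card ι - S.card) := by
  have hli := linearIndependent_cols_of_rank X hrank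
  have hV := finrank_colSpan X hli
  have hW : Module.finrank ℝ (colSpan X (S \ C)) = (S \ C).card :=
    finrank_colSpan X (hli.comp (Set.inclusion (Finset.coe_subset.2 Finset.sdiff_subset))
      (Set.inclusion_injective _))
  have hle : S.card ≤ Fintype.card ι := by
    rw [← hV, ← finrank_euclideanSpace (𝕜 := ℝ)]
    exact Submodule.finrank_le _
  have hWV : colSpan X (S \ C) ≤ colSpan X S := colSpan_mono X Finset.sdiff_subset
  have hmap := stdGaussian_map_norm_sq_projections hWV (k := (C ∩ S).card)
    (m := Fintype.card ι - S.card)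
    (by rw [hV, hW, Finset.inter_comm]; exact Finset.card_sdiff_add_card_inter S C)
    (by rw [hV, finrank_euclideanSpace]; omega)
  rw [pi_gaussianReal_eq_map, fDist, ← hmap, ← map_pi_eq_stdGaussian,
    Measure.map_map (by fun_prop) (by fun_prop), Measure.map_map (by fun_prop) (by fun_prop),
    Measure.map_map (by fun_prop) (by fun_prop)]
  congr 1
  ext z
  simp only [Function.comp_apply, partialFStat]
  rw [rss_add_smul X hm, rss_add_smul X (hWV hm), Nat.cast_sub hle, ← mul_sub, mul_div_assoc,
    mul_div_assoc (σ ^ 2) _ (_ - _), mul_div_mul_left _ _ (by positivity)]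

/-- Validity of the partial F-test: under the null hypothesis, its p-value is stochastically
larger than a uniform variable. -/
theorem measure_partialFPValue_le {S C : Finset κ} {σ : ℝ} (hσ : 0 < σ)
    (hrank : (X.submatrix id (fun j : S => (j : κ))).rank = S.card)
    {m : ι → ℝ} (hm : WithLp.toLp 2 m ∈ colSpan X (S \ C)) {u : ℝ} (hu : 0 ≤ u) :
    (Measure.pi fun _ : ι => gaussianReal 0 (Real.toNNReal (σ ^ 2)))
        {e | partialFPValue X S C (fun i => m i + e i) ≤ u} ≤ ENNReal.ofReal u := by
  set ν := fDist (C ∩ S).card (Fintype.card ι - S.card) with hν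
  have hset : {e : ι → ℝ | partialFPValue X S C (fun i => m i + e i) ≤ u}
      = (fun e => partialFStat X S C fun i => m i + e i) ⁻¹'
        {t | ν (Set.Ici t) ≤ ENNReal.ofReal u} := by
    ext e
    simp only [Set.mem_ofPred_eq, Set.mem_preimage, partialFPValue]
    rw [ENNReal.le_ofReal_iff_toReal_le (measure_ne_top _ _) hu]
    rfl
  have hanti : Antitone fun t : ℝ => ν (Set.Ici t) := fun s t hst =>
    measure_mono (Set.Ici_subset_Ici.2 hst)
  have hmeas : MeasurableSet {t | ν (Set.Ici t) ≤ ENNReal.ofReal u} :=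
    hanti.measurable measurableSet_Iic
  rw [hset, ← Measure.map_apply (by fun_prop) hmeas, map_partialFStat X hσ hrank hm]
  exact measure_tail_le _

/-- For disjoint clusters whose null hypotheses hold, the rejection probabilities of the
multiplicity adjusted p-values add up to at most the level: the adjustment weights a cluster by
its share of the selected variables. -/
theorem sum_measure_adjPValue_le {S : Finset κ} {σ : ℝ} (hσ : 0 < σ)
    (hrank : (X.submatrix id (fun j : S => (j : κ))).rank = S.card)
    {m : ι → ℝ} (F : Finset (Finset κ)) (hF : (F : Set (Finset κ)).PairwiseDisjoint id)
    (hm : ∀ C ∈ F, WithLp.toLp 2 m ∈ colSpan X (S \ C)) {x : ℝ} (hx0 : 0 ≤ x) (hx1 : x < 1) :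
    ∑ C ∈ F, (Measure.pi fun _ : ι => gaussianReal 0 (Real.toNNReal (σ ^ 2)))
        {e | adjPValue X S C (fun i => m i + e i) ≤ x} ≤ ENNReal.ofReal x := by
  have h1 : ∀ C ∈ F, (Measure.pi fun _ : ι => gaussianReal 0 (Real.toNNReal (σ ^ 2)))
        {e | adjPValue X S C (fun i => m i + e i) ≤ x}
      ≤ ENNReal.ofReal (x * ((C ∩ S).card / S.card)) := by
    intro C hC
    by_cases hne : (C ∩ S).Nonempty
    · refine (measure_mono fun e he => ?_).trans
        (measure_partialFPValue_le X hσ hrank (hm C hC) (by positivity))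
      have hc : (0 : ℝ) < (C ∩ S).card := by exact_mod_cast hne.card_pos
      have hs : (0 : ℝ) < S.card := by
        exact_mod_cast (hne.mono Finset.inter_subset_right).card_pos
      simp only [Set.mem_ofPred_eq, adjPValue, clusterPValue, if_pos hne] at he ⊢
      have he' := (min_le_iff.1 he).resolve_right (not_le.2 hx1)
      rw [← mul_div_assoc, div_le_iff₀ hc] at he'
      rw [← mul_div_assoc, le_div_iff₀ hs]
      exact he'
    · simp [adjPValue, hne, not_le.2 hx1]
  refine (Finset.sum_le_sum h1).trans ?_
  rw [← ENNReal.ofReal_sum_of_nonneg fun C _ => by positivity]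
  refine ENNReal.ofReal_le_ofReal ?_
  rw [← Finset.mul_sum, ← Finset.sum_div]
  refine mul_le_of_le_one_right hx0 (div_le_one_of_le₀ ?_ (by positivity))
  rw [← Nat.cast_sum, ← Finset.card_biUnion]
  · exact_mod_cast Finset.card_le_card (Finset.biUnion_subset.2 fun C _ =>
      Finset.inter_subset_right)
  · exact hF.mono_on fun C _ => Finset.inter_subset_left

end FTest

/-! ### Rejection probabilities in a single sample split -/

theorem indepFun_prodMk_left {Ω α β γ : Type*} [MeasurableSpace Ω] [MeasurableSpace α]
    [MeasurableSpace β] [MeasurableSpace γ] {P : Measure Ω} [IsProbabilityMeasure P]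
    {X : Ω → α} {Y : Ω → β} {Z : Ω → γ} (hX : Measurable X) (hY : Measurable Y)
    (hZ : Measurable Z) (h : IndepFun X (fun ω => (Y ω, Z ω)) P) (h' : IndepFun Y Z P) :
    IndepFun (fun ω => (X ω, Y ω)) Z P := by
  have hXp : IsProbabilityMeasure (P.map X) := Measure.isProbabilityMeasure_map hX.aemeasurable
  have hYp : IsProbabilityMeasure (P.map Y) := Measure.isProbabilityMeasure_map hY.aemeasurable
  have hZp : IsProbabilityMeasure (P.map Z) := Measure.isProbabilityMeasure_map hZ.aemeasurable
  have hXY : IndepFun X Y P := h.comp measurable_id measurable_fst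
  rw [indepFun_iff_map_prod_eq_prod_map_map (by fun_prop) (by fun_prop)] at h h' hXY ⊢
  rw [hXY]
  have ha := (measurePreserving_prodAssoc (P.map X) (P.map Y) (P.map Z)).symm
  rw [← ha.map_eq, ← h', ← h, Measure.map_map (MeasurableEquiv.measurable _) (by fun_prop)]
  rfl

namespace Setting

variable {n B : ℕ} (M : Setting.{u, v} n B)

theorem measurable_ε_apply (i : Fin n) : Measurable fun ω => M.ε ω i :=
  (measurable_pi_apply i).comp M.measurable_ε

theorem map_ε_apply (i : Fin n) :
    M.P.map (fun ω => M.ε ω i) = gaussianReal 0 (Real.toNNReal (M.σ ^ 2)) := by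
  have := (measurePreserving_eval
    (fun _ : Fin n => gaussianReal 0 (Real.toNNReal (M.σ ^ 2))) i).map_eq
  rwa [← M.law_ε, Measure.map_map (measurable_pi_apply i) M.measurable_ε] at this

theorem iIndepFun_ε : iIndepFun (fun i ω => M.ε ω i) M.P := by
  rw [iIndepFun_iff_map_fun_eq_pi_map fun i => (M.measurable_ε_apply i).aemeasurable]
  simp_rw [map_ε_apply]
  exact M.law_ε

theorem map_ε_restrict (N : Finset (Fin n)) :
    M.P.map (fun ω (i : N) => M.ε ω i)
      = Measure.pi fun _ => gaussianReal 0 (Real.toNNReal (M.σ ^ 2)) := by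
  have := (iIndepFun_iff_map_fun_eq_pi_map
    fun i : N => (M.measurable_ε_apply i).aemeasurable).1
    (M.iIndepFun_ε.precomp (g := ((↑) : N → Fin n)) Subtype.coe_injective)
  simpa only [map_ε_apply] using this

theorem measurable_ε_restrict (N : Finset (Fin n)) :
    Measurable fun ω (i : N) => M.ε ω i :=
  measurable_pi_lambda _ fun i => M.measurable_ε_apply i

/-- The data that determine the split and the selection are independent of the noise in the
observations that are held out. -/
theorem indepFun_seed_ε (b : Fin B) (N : Finset (Fin n)) :
    IndepFun (fun ω => (M.seed b ω, fun i : N => M.ε ω i))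
      (fun ω (i : (Nᶜ : Finset (Fin n))) => M.ε ω i) M.P := by
  refine indepFun_prodMk_left (M.measurable_seed b) (M.measurable_ε_restrict N)
    (M.measurable_ε_restrict Nᶜ) ?_ (M.iIndepFun_ε.indepFun_finset N Nᶜ disjoint_compl_right M.measurable_ε_apply)
  have := (M.indep.comp (φ := fun e : Fin n → ℝ =>
    ((fun i : N => e i), (fun i : (Nᶜ : Finset (Fin n)) => e i)))
    (ψ := fun s : Fin B → M.R => s b) (by fun_prop) (measurable_pi_apply (X := fun _ => M.R) b)).symm
  exact this

/-- The mean of the response in observation `i`. -/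
noncomputable def mean (i : Fin n) : ℝ := ∑ j, M.X i j * M.β j

/-- The event that in the run `b` the first half of the split is `N` and the selected set
is `S`. -/
def selEvent (b : Fin B) (N : Finset (Fin n)) (S : Finset (Fin M.p)) : Set M.Ω :=
  {ω | M.Nin b ω = N ∧ M.Shat b ω = S}

/-- The values of the seed and of the noise in `N` for which `N` is the first half of the split
and `S` is selected. -/
def selSet (N : Finset (Fin n)) (S : Finset (Fin M.p)) : Set (M.R × (N → ℝ)) :=
  {q | M.split q.1 = N ∧ M.screen q.1 N (M.X.submatrix (fun i : N => (i : Fin n)) id)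
    (fun i => M.mean i + q.2 i) = S}

theorem measurableSet_selSet (N : Finset (Fin n)) (S : Finset (Fin M.p)) :
    MeasurableSet (M.selSet N S) := by
  refine (measurable_fst (M.measurable_split N)).inter ?_
  have hf : Measurable fun q : M.R × (N → ℝ) => (q.1, fun i : N => M.mean i + q.2 i) := by
    fun_prop
  exact hf (M.measurable_screen N S)

theorem selEvent_eq (b : Fin B) (N : Finset (Fin n)) (S : Finset (Fin M.p)) :
    M.selEvent b N S = (fun ω => (M.seed b ω, fun i : N => M.ε ω i)) ⁻¹' M.selSet N S := by
  ext ω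
  constructor
  · rintro ⟨rfl, rfl⟩
    exact ⟨rfl, rfl⟩
  · rintro ⟨h1, h2⟩
    simp only at h1 h2
    subst h1
    exact ⟨rfl, h2⟩

theorem measurableSet_selEvent (b : Fin B) (N : Finset (Fin n)) (S : Finset (Fin M.p)) :
    MeasurableSet (M.selEvent b N S) := by
  rw [selEvent_eq]
  exact ((M.measurable_seed b).prodMk (M.measurable_ε_restrict N)) (M.measurableSet_selSet N S)

/-- The adjusted p-value of the cluster `C` for a given split and a given selected set, as a
function of the noise in the observations that are held out. -/
noncomputable def fixedPValue (N : Finset (Fin n)) (S C : Finset (Fin M.p))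
    (e : (Nᶜ : Finset (Fin n)) → ℝ) : ℝ :=
  adjPValue (M.X.submatrix (fun i : (Nᶜ : Finset (Fin n)) => (i : Fin n)) id) S C
    fun i => M.mean i + e i

theorem measurable_fixedPValue (N : Finset (Fin n)) (S C : Finset (Fin M.p)) :
    Measurable (M.fixedPValue N S C) :=
  (measurable_adjPValue _ S C).comp
    (measurable_pi_lambda _ fun i => measurable_const.add (measurable_pi_apply i))

theorem padj_eq {b : Fin B} {N : Finset (Fin n)} {S : Finset (Fin M.p)} {ω : M.Ω}
    (h : ω ∈ M.selEvent b N S) (C : Finset (Fin M.p)) :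
    M.padj C b ω = M.fixedPValue N S C fun i => M.ε ω i := by
  obtain ⟨rfl, rfl⟩ := h
  rfl

theorem measurable_padj (C : Finset (Fin M.p)) (b : Fin B) : Measurable (M.padj C b) := by
  intro s hs
  have : M.padj C b ⁻¹' s = ⋃ q : Finset (Fin n) × Finset (Fin M.p), M.selEvent b q.1 q.2 ∩
      {ω | M.fixedPValue q.1 q.2 C (fun i => M.ε ω i) ∈ s} := by
    ext ω
    simp only [Set.mem_preimage, Set.mem_iUnion]
    constructor
    · intro h
      have hω : ω ∈ M.selEvent b (M.Nin b ω) (M.Shat b ω) := ⟨rfl, rfl⟩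
      rw [M.padj_eq hω] at h
      exact ⟨(M.Nin b ω, M.Shat b ω), hω, h⟩
    · rintro ⟨q, hω, h⟩
      rw [M.padj_eq hω]
      exact h
  rw [this]
  exact MeasurableSet.iUnion fun q => (M.measurableSet_selEvent b q.1 q.2).inter
    (((M.measurable_fixedPValue q.1 q.2 C).comp (M.measurable_ε_restrict q.1ᶜ)) hs)

theorem measurableSet_screening (b : Fin B) : MeasurableSet {ω | M.S₀ ⊆ M.Shat b ω} := by
  have : {ω | M.S₀ ⊆ M.Shat b ω} = ⋃ q : {q : Finset (Fin n) × Finset (Fin M.p) // M.S₀ ⊆ q.2},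
      M.selEvent b q.1.1 q.1.2 := by
    ext ω
    simp only [Set.mem_iUnion]
    constructor
    · intro h
      exact ⟨⟨(M.Nin b ω, M.Shat b ω), h⟩, rfl, rfl⟩
    · rintro ⟨q, h1, h2⟩
      change M.S₀ ⊆ M.Shat b ω
      rw [h2]
      exact q.2
  rw [this]
  exact MeasurableSet.iUnion fun q => M.measurableSet_selEvent b _ _

/-- If the selected set contains the active set, the mean of the responses remains in the column
span after deleting a cluster without active variables. -/
theorem mean_mem_colSpan {S C : Finset (Fin M.p)} (hS : M.S₀ ⊆ S) (hC : ∀ j ∈ C, M.β j = 0)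
    (N : Finset (Fin n)) :
    (WithLp.toLp 2 fun i : N => M.mean i) ∈
      colSpan (M.X.submatrix (fun i : N => (i : Fin n)) id) (S \ C) := by
  refine (mem_colSpan _).2 ⟨M.β, fun i => ?_⟩
  refine (Finset.sum_subset (Finset.subset_univ (S \ C)) fun j _ hj => ?_).symm
  have : M.β j = 0 := by
    by_contra h
    have hjS : j ∈ S := hS (Finset.mem_filter.2 ⟨Finset.mem_univ j, h⟩)
    exact hj (Finset.mem_sdiff.2 ⟨hjS, fun hjC => h (hC j hjC)⟩)
  rw [this, mul_zero]

/-- In a single split, the probabilities of false rejections at level `x` of disjoint clusters,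
on the event of a successful screening, add up to at most `x`. -/
theorem sum_measure_padj_le (hrank : M.FullRank) (b : Fin B) {F : Finset (Finset (Fin M.p))}
    (hF : (F : Set (Finset (Fin M.p))).PairwiseDisjoint id)
    (hnull : ∀ C ∈ F, ∀ j ∈ C, M.β j = 0) {x : ℝ} (hx0 : 0 ≤ x) (hx1 : x < 1) :
    ∑ C ∈ F, M.P {ω | M.S₀ ⊆ M.Shat b ω ∧ M.padj C b ω ≤ x} ≤ ENNReal.ofReal x := by
  classical
  set good : Finset (Finset (Fin n) × Finset (Fin M.p)) := Finset.univ.filter fun q =>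
    M.S₀ ⊆ q.2 ∧ ((M.X.submatrix (fun i : (q.1ᶜ : Finset (Fin n)) => (i : Fin n)) id).submatrix
      id (fun j : q.2 => (j : Fin M.p))).rank = q.2.card with hgood
  have h1 : ∀ C, M.P {ω | M.S₀ ⊆ M.Shat b ω ∧ M.padj C b ω ≤ x} ≤ ∑ q ∈ good,
      M.P (M.selEvent b q.1 q.2) * (Measure.pi fun _ : (q.1ᶜ : Finset (Fin n)) =>
        gaussianReal 0 (Real.toNNReal (M.σ ^ 2))) {e | M.fixedPValue q.1 q.2 C e ≤ x} := by
    intro C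
    have hcover : M.P {ω | M.S₀ ⊆ M.Shat b ω ∧ M.padj C b ω ≤ x} ≤
        M.P (⋃ q ∈ good, M.selEvent b q.1 q.2 ∩
          {ω | M.fixedPValue q.1 q.2 C (fun i => M.ε ω i) ≤ x}) := by
      refine measure_mono_ae ?_
      filter_upwards [hrank b] with ω hω
      rintro ⟨hS, hp⟩
      have hsel : ω ∈ M.selEvent b (M.Nin b ω) (M.Shat b ω) := ⟨rfl, rfl⟩
      rw [M.padj_eq hsel] at hp
      exact Set.mem_biUnion (x := (M.Nin b ω, M.Shat b ω))
        (Finset.mem_filter.2 ⟨Finset.mem_univ _, hS, hω⟩) ⟨hsel, hp⟩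
    refine hcover.trans ((measure_biUnion_finset_le _ _).trans (Finset.sum_le_sum fun q _ => ?_))
    have hs : MeasurableSet {e | M.fixedPValue q.1 q.2 C e ≤ x} :=
      M.measurable_fixedPValue q.1 q.2 C measurableSet_Iic
    rw [selEvent_eq, ← M.map_ε_restrict, Measure.map_apply (M.measurable_ε_restrict _) hs]
    exact ((M.indepFun_seed_ε b q.1).measure_inter_preimage_eq_mul _ _
      (M.measurableSet_selSet q.1 q.2) hs).le
  refine (Finset.sum_le_sum fun C _ => h1 C).trans ?_
  rw [Finset.sum_comm]
  have h2 : ∀ q ∈ good, ∑ C ∈ F, M.P (M.selEvent b q.1 q.2) *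
      (Measure.pi fun _ : (q.1ᶜ : Finset (Fin n)) =>
        gaussianReal 0 (Real.toNNReal (M.σ ^ 2))) {e | M.fixedPValue q.1 q.2 C e ≤ x}
      ≤ M.P (M.selEvent b q.1 q.2) * ENNReal.ofReal x := by
    intro q hq
    obtain ⟨hS, hr⟩ := (Finset.mem_filter.1 hq).2
    rw [← Finset.mul_sum]
    refine mul_le_mul_right ?_ _
    exact sum_measure_adjPValue_le _ M.σ_pos hr F hF
      (fun C hC => M.mean_mem_colSpan hS (hnull C hC) _) hx0 hx1
  refine (Finset.sum_le_sum h2).trans ?_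
  rw [← Finset.sum_mul]
  refine mul_le_of_le_one_left zero_le ?_
  rw [← measure_biUnion_finset]
  · exact prob_le_one
  · intro q _ q' _ hqq'
    refine Set.disjoint_left.2 fun ω h h' => hqq' ?_
    exact Prod.ext (h.1.symm.trans h'.1) (h.2.symm.trans h'.2)
  · exact fun q _ => M.measurableSet_selEvent b q.1 q.2

end Setting

/-! ### Aggregation rules dominated by a measure on levels -/

/-- The data for a Markov bound on an aggregation rule at level `α`. For every `a` slightly above
`α` there is a measure `ν` on levels `s ∈ [0, 1)` with `∫ s dν ≤ a`, such that p-values `p_b` whose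
aggregate is at most `α` satisfy `∑ b, ν {s | p_b ≤ s} ≥ B`. -/
def LevelDominated {B : ℕ} (agg : (Fin B → ℝ) → ℝ) (α : ℝ) : Prop :=
  ∀ a ∈ Set.Ioo α 1, ∃ ν : Measure ℝ, SFinite ν ∧ (∀ᵐ s ∂ν, s ∈ Set.Ico (0 : ℝ) 1) ∧
    ∫⁻ s, ENNReal.ofReal s ∂ν ≤ ENNReal.ofReal a ∧
    ∀ p : Fin B → ℝ, agg p ≤ α → (B : ENNReal) ≤ ∑ b, ν (Set.Ici (p b))

/-- If the aggregated p-value is less than `a`, at least a fraction `γ` of the p-values is at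
most `a γ`. The strict inequality avoids the question whether the quantile is attained. -/
theorem card_of_aggQ_lt {B : ℕ} {γ a : ℝ} (hγ : γ ∈ Set.Ioo (0 : ℝ) 1) (ha : a ≤ 1)
    {p : Fin B → ℝ} (h : aggQ γ p < a) :
    γ * B ≤ ((Finset.univ.filter fun b => p b ≤ a * γ).card : ℝ) := by
  have hq : empQuantile γ (fun b => p b / γ) < a := (min_lt_iff.1 h).resolve_left (not_lt.2 ha)
  have hne : {t : ℝ | γ * (B : ℝ) ≤
      ((Finset.univ.filter fun b => p b / γ ≤ t).card : ℝ)}.Nonempty := by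
    refine ⟨∑ b, |p b / γ|, ?_⟩
    have : (Finset.univ.filter fun b => p b / γ ≤ ∑ b, |p b / γ|) = Finset.univ :=
      Finset.filter_true_of_mem fun b hb => (le_abs_self _).trans
        (Finset.single_le_sum (f := fun b => |p b / γ|) (fun _ _ => abs_nonneg _) hb)
    rw [Set.mem_ofPred_eq, this, Finset.card_univ, Fintype.card_fin]
    exact mul_le_of_le_one_left (Nat.cast_nonneg B) hγ.2.le
  -- non-emptiness is needed here, since the infimum of the empty set would be `0`
  obtain ⟨t, ht, hta⟩ := exists_lt_of_csInf_lt hne hq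
  refine le_trans ht (Nat.cast_le.2 (Finset.card_le_card fun b hb => ?_))
  rw [Finset.mem_filter] at hb ⊢
  exact ⟨hb.1, (div_le_iff₀ hγ.1).1 (hb.2.trans hta.le)⟩

/-- A measure that gives mass at least `1 / γ` to the levels above `a γ` gives total mass at least
`B` to p-values of which a fraction `γ` is at most `a γ`. -/
theorem le_sum_measure_Ici {B : ℕ} {γ a : ℝ} (hγ : 0 < γ) {p : Fin B → ℝ} {ν : Measure ℝ}
    (h : γ * B ≤ ((Finset.univ.filter fun b => p b ≤ a * γ).card : ℝ))
    (hν : ENNReal.ofReal (1 / γ) ≤ ν (Set.Ici (a * γ))) :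
    (B : ENNReal) ≤ ∑ b, ν (Set.Ici (p b)) := by
  have h1 : ∀ b ∈ Finset.univ.filter (fun b => p b ≤ a * γ),
      ENNReal.ofReal (1 / γ) ≤ ν (Set.Ici (p b)) := fun b hb =>
    hν.trans (measure_mono (Set.Ici_subset_Ici.2 (Finset.mem_filter.1 hb).2))
  calc (B : ENNReal)
      ≤ (Finset.univ.filter fun b => p b ≤ a * γ).card • ENNReal.ofReal (1 / γ) := by
        rw [← ENNReal.ofReal_natCast, ← ENNReal.ofReal_nsmul]
        refine ENNReal.ofReal_le_ofReal ?_
        rw [nsmul_eq_mul, mul_one_div, le_div_iff₀ hγ, mul_comm]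
        exact h
    _ ≤ ∑ b ∈ Finset.univ.filter (fun b => p b ≤ a * γ), ν (Set.Ici (p b)) :=
        Finset.card_nsmul_le_sum _ _ _ h1
    _ ≤ ∑ b, ν (Set.Ici (p b)) := Finset.sum_le_sum_of_subset (Finset.subset_univ _)

/-- For a fixed `γ`, the measure on levels is a point mass `1 / γ` at `a γ`. -/
theorem levelDominated_aggQ {B : ℕ} {γ α : ℝ} (hγ : γ ∈ Set.Ioo (0 : ℝ) 1) (hα : 0 < α) :
    LevelDominated (aggQ (B := B) γ) α := by
  rintro a ⟨hαa, ha1⟩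
  have hγ0 : 0 < γ := hγ.1
  have ha0 : 0 < a := hα.trans hαa
  refine ⟨ENNReal.ofReal (1 / γ) • Measure.dirac (a * γ), inferInstance, ?_, ?_, fun p hp => ?_⟩
  · refine Measure.ae_smul_measure ?_ _
    exact (ae_dirac_iff (p := (· ∈ Set.Ico (0 : ℝ) 1)) measurableSet_Ico).2
      ⟨by positivity, by nlinarith [hγ.2]⟩
  · rw [lintegral_smul_measure, lintegral_dirac' _ ENNReal.measurable_ofReal, smul_eq_mul,
      ← ENNReal.ofReal_mul (by positivity)]
    refine (congrArg ENNReal.ofReal ?_).le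
    field_simp
  · refine le_sum_measure_Ici hγ0 (card_of_aggQ_lt hγ ha1.le (hp.trans_lt hαa)) ?_
    simp

theorem lintegral_ofReal_div_Ioo {a c : ℝ} (ha : 0 ≤ a) (hc : 1 ≤ c) :
    ∫⁻ t in Set.Ioo 1 c, ENNReal.ofReal (a / t) = ENNReal.ofReal (a * Real.log c) := by
  have hpos : ∀ t ∈ Set.Ioo 1 c, 0 ≤ a / t := fun t ht =>
    div_nonneg ha (zero_le_one.trans ht.1.le)
  have hint : IntegrableOn (fun t : ℝ => a / t) (Set.Icc 1 c) :=
    ContinuousOn.integrableOn_Icc (continuousOn_const.div continuousOn_id fun t ht =>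
      (zero_lt_one.trans_le ht.1).ne')
  rw [← ofReal_integral_eq_lintegral_ofReal (hint.mono_set Set.Ioo_subset_Icc_self)
    ((ae_restrict_iff' measurableSet_Ioo).2 (Eventually.of_forall hpos)),
    ← integral_Ioc_eq_integral_Ioo, ← intervalIntegral.integral_of_le hc]
  simp_rw [div_eq_mul_inv]
  rw [intervalIntegral.integral_const_mul, integral_inv_of_pos one_pos (one_pos.trans_le hc),
    div_one]

/-- For an optimized `γ`, the measure on levels is a unit mass at `a` together with the
image of Lebesgue measure on `(1, 1 / γmin)` under `t ↦ a / t`. It gives mass at least `1 / γ` to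
the levels above `a γ`, for all `γ` simultaneously, at the price of the factor `1 - log γmin`. -/
theorem levelDominated_aggP {B : ℕ} {γmin α : ℝ} (hγ : γmin ∈ Set.Ioo (0 : ℝ) 1) (hα : 0 < α) :
    LevelDominated (aggP (B := B) γmin) α := by
  rintro a' ⟨hαa, ha1⟩
  have hγ0 : 0 < γmin := hγ.1
  have hlog : Real.log γmin < 0 := Real.log_neg hγ.1 hγ.2
  set c := 1 - Real.log γmin with hc
  have hc1 : 1 < c := by linarith
  have hc0 : 0 < c := by linarith
  set a := a' / c with ha
  have ha'0 : 0 < a' := hα.trans hαa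
  have ha0 : 0 < a := by positivity
  have haa : a < 1 := (div_lt_one hc0).2 (ha1.trans hc1)
  have hmeas : Measurable fun t : ℝ => a / t := by fun_prop
  refine ⟨Measure.dirac a + (volume.restrict (Set.Ioo 1 (1 / γmin))).map fun t => a / t,
    inferInstance, ?_, ?_, fun p hp => ?_⟩
  · rw [ae_add_measure_iff]
    constructor
    · exact (ae_dirac_iff (p := (· ∈ Set.Ico (0 : ℝ) 1)) measurableSet_Ico).2 ⟨ha0.le, haa⟩
    · refine (ae_map_iff (p := (· ∈ Set.Ico (0 : ℝ) 1)) hmeas.aemeasurable measurableSet_Ico).2 ?_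
      refine (ae_restrict_iff' measurableSet_Ioo).2 (Eventually.of_forall fun t ht => ?_)
      have ht0 : 0 < t := one_pos.trans ht.1
      exact ⟨by positivity, (div_lt_one ht0).2 (haa.trans ht.1)⟩
  · rw [lintegral_add_measure, lintegral_dirac' _ ENNReal.measurable_ofReal,
      lintegral_map ENNReal.measurable_ofReal hmeas,
      lintegral_ofReal_div_Ioo ha0.le ((one_le_div hγ0).2 hγ.2.le), one_div, Real.log_inv,
      ← ENNReal.ofReal_add ha0.le (mul_nonneg ha0.le (by linarith))]
    refine (congrArg ENNReal.ofReal ?_).le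
    rw [← mul_one_add, ← sub_eq_add_neg, ← hc, ha, div_mul_cancel₀ _ hc0.ne']
  · -- the infimum over `γ` need not be attained; the gap between `α` and `a'` makes up for this
    have hinf : ⨅ γ : Set.Ioo γmin 1, aggQ (γ : ℝ) p < a := by
      have := (min_le_iff.1 hp).resolve_left (not_le.2 (hαa.trans ha1))
      rw [ha, lt_div_iff₀ hc0, mul_comm]
      exact this.trans_lt hαa
    have : Nonempty (Set.Ioo γmin 1) := (Set.nonempty_Ioo.2 hγ.2).to_subtype
    obtain ⟨⟨γ, hγm, hγ1⟩, hlt⟩ := exists_lt_of_ciInf_lt hinf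
    have hγpos : 0 < γ := hγ0.trans hγm
    refine le_sum_measure_Ici hγpos (card_of_aggQ_lt ⟨hγpos, hγ1⟩ haa.le hlt) ?_
    have hle : 1 ≤ 1 / γ := (one_le_div hγpos).2 hγ1.le
    rw [Measure.add_apply, Measure.map_apply hmeas measurableSet_Ici,
      Measure.dirac_apply' _ measurableSet_Ici, Set.indicator_of_mem
      (Set.mem_Ici.2 (mul_le_of_le_one_right ha0.le hγ1.le)), Pi.one_apply,
      Measure.restrict_apply (hmeas measurableSet_Ici)]
    have hsub : Set.Ioo 1 (1 / γ) ⊆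
        (fun t => a / t) ⁻¹' Set.Ici (a * γ) ∩ Set.Ioo 1 (1 / γmin) := by
      rintro t ⟨ht1, ht2⟩
      have ht0 : 0 < t := one_pos.trans ht1
      refine ⟨?_, ht1, ht2.trans_le (one_div_le_one_div_of_le hγ0 hγm.le)⟩
      rw [Set.mem_preimage, Set.mem_Ici, le_div_iff₀ ht0, mul_assoc]
      rw [lt_div_iff₀ hγpos] at ht2
      exact mul_le_of_le_one_right ha0.le (by rw [mul_comm]; exact ht2.le)
    refine le_trans ?_ (add_le_add_right (measure_mono hsub) 1)
    rw [Real.volume_Ioo, ← ENNReal.ofReal_one, ← ENNReal.ofReal_add zero_le_one (by linarith)]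
    simp

/-! ### Familywise error of the hierarchical procedure -/

/-- Tonelli's theorem: the expected `ν`-mass of the levels reached by a p-value is the `ν`-integral
of its rejection probability at level `s`. -/
theorem setLIntegral_measure_Ici {Ω : Type*} [MeasurableSpace Ω] {P : Measure Ω} [SFinite P]
    {ν : Measure ℝ} [SFinite ν] {p : Ω → ℝ} (hp : Measurable p) {E : Set Ω}
    (hE : MeasurableSet E) :
    ∫⁻ ω in E, ν (Set.Ici (p ω)) ∂P = ∫⁻ s, P {ω | ω ∈ E ∧ p ω ≤ s} ∂ν := by
  have hs : MeasurableSet {q : Ω × ℝ | p q.1 ≤ q.2} :=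
    measurableSet_le (hp.comp measurable_fst) measurable_snd
  have h1 := Measure.prod_apply (μ := P.restrict E) (ν := ν) hs
  have h2 := Measure.prod_apply_symm (μ := P.restrict E) (ν := ν) hs
  refine h1.symm.trans (h2.trans (lintegral_congr fun s => ?_))
  rw [Measure.restrict_apply' hE, Set.inter_comm]
  rfl

namespace Setting

variable {n B : ℕ} (M : Setting.{u, v} n B)

open Classical in
/-- The maximal clusters among those whose null hypothesis holds. -/
noncomputable def maxNull : Finset (Finset (Fin M.p)) :=
  M.T.filter fun C => Maximal (· ∈ M.T₀) C

theorem mem_maxNull {C : Finset (Fin M.p)} :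
    C ∈ M.maxNull ↔ C ∈ M.T ∧ Maximal (· ∈ M.T₀) C := by
  classical
  exact Finset.mem_filter

theorem pairwiseDisjoint_maxNull :
    (M.maxNull : Set (Finset (Fin M.p))).PairwiseDisjoint id := by
  intro C hC D hD hCD
  obtain ⟨hCT, hC⟩ := M.mem_maxNull.1 (Finset.mem_coe.1 hC)
  obtain ⟨hDT, hD⟩ := M.mem_maxNull.1 (Finset.mem_coe.1 hD)
  rcases M.laminar C hCT D hDT with h | h | h
  · exact absurd (hC.eq_of_le hD.prop h) hCD
  · exact absurd (hD.eq_of_le hC.prop h).symm hCD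
  · exact h

/-- A rejected true null hypothesis lies below a maximal one, whose own aggregated p-value is a term
of the maximum that defines the hierarchical adjustment. -/
theorem exists_mem_maxNull {C : Finset (Fin M.p)} (hC : C ∈ M.T₀) :
    ∃ D ∈ M.maxNull, D ∈ M.above C := by
  obtain ⟨D, hCD, hD⟩ := (Set.toFinite M.T₀).exists_le_maximal hC
  exact ⟨D, M.mem_maxNull.2 ⟨hD.prop.1, hD⟩, Finset.mem_filter.2 ⟨hD.prop.1, hCD⟩⟩

/-- The Markov bound for disjoint clusters: the probability that for one of them the levels reached
by the p-values of all splits have total `ν`-mass at least `B`. -/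
theorem measure_exists_le_sum_measure_Ici_le (hB : 1 ≤ B) (hrank : M.FullRank)
    {F : Finset (Finset (Fin M.p))} (hF : (F : Set (Finset (Fin M.p))).PairwiseDisjoint id)
    (hnull : ∀ C ∈ F, ∀ j ∈ C, M.β j = 0) {ν : Measure ℝ} [SFinite ν]
    (hν : ∀ᵐ s ∂ν, s ∈ Set.Ico (0 : ℝ) 1) :
    M.P {ω | (∀ b, M.S₀ ⊆ M.Shat b ω) ∧
      ∃ C ∈ F, (B : ENNReal) ≤ ∑ b, ν (Set.Ici (M.padj C b ω))}
      ≤ ∫⁻ s, ENNReal.ofReal s ∂ν := by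
  set E : Fin B → Set M.Ω := fun b => {ω | M.S₀ ⊆ M.Shat b ω} with hE
  have hEm : ∀ b, MeasurableSet (E b) := M.measurableSet_screening
  have hIci : Measurable fun t : ℝ => ν (Set.Ici t) :=
    Antitone.measurable fun s t hst => measure_mono (Set.Ici_subset_Ici.2 hst)
  have hm : ∀ C b, Measurable ((E b).indicator fun ω => ν (Set.Ici (M.padj C b ω))) :=
    fun C b => (hIci.comp (M.measurable_padj C b)).indicator (hEm b)
  set g : M.Ω → ENNReal := fun ω =>
    ∑ b, ∑ C ∈ F, (E b).indicator (fun ω => ν (Set.Ici (M.padj C b ω))) ω with hg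
  have hgm : Measurable g :=
    Finset.measurable_sum _ fun b _ => Finset.measurable_sum _ fun C _ => hm C b
  have hsub : {ω | (∀ b, M.S₀ ⊆ M.Shat b ω) ∧
      ∃ C ∈ F, (B : ENNReal) ≤ ∑ b, ν (Set.Ici (M.padj C b ω))} ⊆ {ω | (B : ENNReal) ≤ g ω} := by
    rintro ω ⟨hS, C, hC, hle⟩
    refine le_trans hle (Finset.sum_le_sum fun b _ => ?_)
    rw [← Set.indicator_of_mem (show ω ∈ E b from hS b) fun ω => ν (Set.Ici (M.padj C b ω))]
    exact Finset.single_le_sum (f := fun C =>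
      (E b).indicator (fun ω => ν (Set.Ici (M.padj C b ω))) ω) (fun _ _ => zero_le) hC
  have hint : ∫⁻ ω, g ω ∂M.P ≤ B * ∫⁻ s, ENNReal.ofReal s ∂ν := by
    rw [hg, lintegral_finsetSum _ fun b _ => Finset.measurable_sum _ fun C _ => hm C b]
    have : ∀ b ∈ Finset.univ, ∫⁻ ω, ∑ C ∈ F,
        (E b).indicator (fun ω => ν (Set.Ici (M.padj C b ω))) ω ∂M.P
          ≤ ∫⁻ s, ENNReal.ofReal s ∂ν := by
      intro b _
      rw [lintegral_finsetSum _ fun C _ => hm C b]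
      simp_rw [lintegral_indicator (hEm b),
        setLIntegral_measure_Ici (M.measurable_padj _ b) (hEm b)]
      rw [← lintegral_finsetSum]
      · refine lintegral_mono_ae ?_
        filter_upwards [hν] with s hs
        exact M.sum_measure_padj_le hrank b hF hnull hs.1 hs.2
      · exact fun C _ => Monotone.measurable fun s t hst =>
          measure_mono fun ω hω => ⟨hω.1, hω.2.trans hst⟩
    refine (Finset.sum_le_sum this).trans_eq ?_
    simp
  have hmarkov := (mul_meas_ge_le_lintegral (μ := M.P) hgm (B : ENNReal)).trans hint
  have hB0 : (B : ENNReal) ≠ 0 := by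
    exact_mod_cast (by omega : B ≠ 0)
  exact (measure_mono hsub).trans
    ((ENNReal.mul_le_mul_iff_right hB0 (ENNReal.natCast_ne_top B)).1 hmarkov)

/-- Non-asymptotic familywise error bound: the probability of a false rejection exceeds the level
by at most the probability that the screening fails in some split. -/
theorem measure_false_rejection_le (hB : 1 ≤ B) (hrank : M.FullRank)
    {agg : (Fin B → ℝ) → ℝ} {α : ℝ} (hα : α < 1) (hagg : LevelDominated agg α) :
    M.P {ω | ({C | C ∈ M.T ∧ (M.above C).sup' (M.above_nonempty C)
      (fun D => agg fun b => M.padj D b ω) ≤ α} ∩ M.T₀).Nonempty}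
      ≤ ENNReal.ofReal α + ∑ b, (1 - M.P {ω | M.S₀ ⊆ M.Shat b ω}) := by
  have hscreen : M.P {ω | ∀ b, M.S₀ ⊆ M.Shat b ω}ᶜ
      ≤ ∑ b, (1 - M.P {ω | M.S₀ ⊆ M.Shat b ω}) := by
    have : {ω | ∀ b, M.S₀ ⊆ M.Shat b ω}ᶜ = ⋃ b, {ω | M.S₀ ⊆ M.Shat b ω}ᶜ := by
      ext ω
      simp
    rw [this]
    refine (measure_iUnion_fintype_le _ _).trans (Finset.sum_le_sum fun b _ => ?_)
    rw [prob_compl_eq_one_sub (M.measurableSet_screening b)]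
  have hmain : M.P {ω | (∀ b, M.S₀ ⊆ M.Shat b ω) ∧
      ∃ C ∈ M.maxNull, agg (fun b => M.padj C b ω) ≤ α} ≤ ENNReal.ofReal α := by
    have hbound : ∀ᶠ a in 𝓝[>] α, M.P {ω | (∀ b, M.S₀ ⊆ M.Shat b ω) ∧
        ∃ C ∈ M.maxNull, agg (fun b => M.padj C b ω) ≤ α} ≤ ENNReal.ofReal a := by
      filter_upwards [Ioo_mem_nhdsGT hα] with a ha
      obtain ⟨ν, hsf, hν, hint, hle⟩ := hagg a ha
      refine le_trans (measure_mono ?_) ((M.measure_exists_le_sum_measure_Ici_le hB hrank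
        M.pairwiseDisjoint_maxNull (fun C hC => (M.mem_maxNull.1 hC).2.prop.2) hν).trans hint)
      rintro ω ⟨hS, C, hC, hCα⟩
      exact ⟨hS, C, hC, hle _ hCα⟩
    exact ge_of_tendsto (ENNReal.continuous_ofReal.continuousAt.tendsto.mono_left
      nhdsWithin_le_nhds) hbound
  refine (measure_mono ?_).trans ((measure_union_le _ _).trans (add_le_add hmain hscreen))
  rintro ω ⟨C, ⟨-, hC⟩, hC0⟩
  by_cases hS : ∀ b, M.S₀ ⊆ M.Shat b ω
  · obtain ⟨D, hD, hDC⟩ := M.exists_mem_maxNull hC0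
    exact Or.inl ⟨hS, D, hD, (Finset.le_sup' (fun D => agg fun b => M.padj D b ω) hDC).trans hC⟩
  · exact Or.inr hS

/-- If the screening succeeds asymptotically in every split, the hierarchical procedure based on a
dominated aggregation rule asymptotically controls the familywise error. -/
theorem limsup_measure_false_rejection_le (hB : 1 ≤ B) (M : (n : ℕ) → Setting.{u, v} n B)
    (hrank : ∀ n, 1 ≤ n → (M n).FullRank)
    (hscreen : ∀ b, Tendsto (fun n => (M n).P {ω | (M n).S₀ ⊆ (M n).Shat b ω}) atTop (𝓝 1))
    {agg : (Fin B → ℝ) → ℝ} {α : ℝ} (hα : α < 1) (hagg : LevelDominated agg α) :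
    limsup (fun n => (M n).P {ω | ({C | C ∈ (M n).T ∧ ((M n).above C).sup'
      ((M n).above_nonempty C) (fun D => agg fun b => (M n).padj D b ω) ≤ α}
        ∩ (M n).T₀).Nonempty}) atTop ≤ ENNReal.ofReal α := by
  have hlim : Tendsto (fun n => ENNReal.ofReal α +
      ∑ b, (1 - (M n).P {ω | (M n).S₀ ⊆ (M n).Shat b ω})) atTop (𝓝 (ENNReal.ofReal α)) := by
    have h : ∀ b ∈ Finset.univ,
        Tendsto (fun n => 1 - (M n).P {ω | (M n).S₀ ⊆ (M n).Shat b ω}) atTop (𝓝 0) := fun b _ => by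
      simpa using ENNReal.Tendsto.sub (tendsto_const_nhds (x := (1 : ENNReal))) (hscreen b)
        (Or.inl ENNReal.one_ne_top)
    simpa using (tendsto_const_nhds (x := ENNReal.ofReal α)).add (tendsto_finsetSum _ h)
  refine le_trans (limsup_le_limsup ?_) hlim.limsup_eq.le
  filter_upwards [eventually_ge_atTop 1] with n hn
  exact (M n).measure_false_rejection_le hB (hrank n hn) hα hagg

end Setting

end HierTest

theorem corollary1 {B : ℕ} (hB : 1 ≤ B) (M : (n : ℕ) → HierTest.Setting.{u, v} n B)
    (hA1 : ∀ n, 1 ≤ n → (M n).Sparsity)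
    (hrank : ∀ n, 1 ≤ n → (M n).FullRank)
    (hA2 : ∀ b, Tendsto (fun n => (M n).P {ω | (M n).S₀ ⊆ (M n).Shat b ω}) atTop (𝓝 1))
    (γ γmin α : ℝ) (hγ : γ ∈ Set.Ioo (0 : ℝ) 1) (hγmin : γmin ∈ Set.Ioo (0 : ℝ) 1)
    (hα : α ∈ Set.Ioo (0 : ℝ) 1) :
    limsup (fun n => (M n).P {ω | ((M n).TrejQ γ α ω ∩ (M n).T₀).Nonempty}) atTop
        ≤ ENNReal.ofReal α ∧
      limsup (fun n => (M n).P {ω | ((M n).TrejP γmin α ω ∩ (M n).T₀).Nonempty}) atTop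
        ≤ ENNReal.ofReal α :=
  ⟨HierTest.Setting.limsup_measure_false_rejection_le hB M hrank hA2 hα.2
      (HierTest.levelDominated_aggQ hγ hα.1),
    HierTest.Setting.limsup_measure_false_rejection_le hB M hrank hA2 hα.2
      (HierTest.levelDominated_aggP hγmin hα.1)⟩
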